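/- A three-dimensional DMAC instance is a function $f : G \to G$ on a grid $G = \{1,\dots,n\}^3$ with $n \ge 1$, ordered coordinatewise. It is *violation-free* if $x \le y$ implies $f(x) \le f(y)$ and $\|f(x)-f(y)\|_\infty \le \|x-y\|_\infty$ for all $x,y \in G$. It is a *1DUniqueDMAC* instance if $\|x-f(x)\|_\infty \le 1$ for all $x \in G$ and if, for every $x \in G$ and every dimension $i$, there is exactly one point $y \in G$ that agrees with $x$ in all coordinates other than $i$ and satisfies $f_i(y)=y_i$. An instance is given to an algorithm as the pair $\langle n, M\rangle$, with $n$ in binary and $M$ the source code of a program that computes $f$ (with points written in binary); if $M$ halts on every point of $G$ within time $T$, we say that $M$ represents $f$ with evaluation time $T$. Write $|\langle n, M\rangle|$ for the length of the description. Programs and running times are those of a fixed structured programming language on binary trees, in which every elementary operation is charged the size of the data it handles; this model is polynomially equivalent to Turing machines. **Lemma.** There are programs $R$ and $B$ and a polynomial $q$ such that the following holds for every $n \ge 1$ and every violation-free $f : \{1,\dots,n\}^3 \to \{1,\dots,n\}^3$. There is a function $f' : G' \to G'$ on the grid $G' = \{1,\dots,4n+5\}^3$ (the quarter-integer grid $\{0,\tfrac14,\tfrac12,\dots,n+1\}^3$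 rescaled to unit spacing, so that index $k$ stands for the coordinate $(k-1)/4$) such that 1. $f'$ is a violation-free 1DUniqueDMAC instance; 2. $f'$ has exactly one fixed point $x^*$, and $f$ has a least fixed point $p$; 3. for every program $M$ that represents $f$ with evaluation time $T$: * on input $\langle n, M\rangle$ the program $R$ halts within time $q(|\langle n, M\rangle|)$ and outputs $\langle 4n+5, M'\rangle$, where $M'$ represents $f'$ with evaluation time $q(|\langle n, M\rangle| + T)$; * on input $(\langle n, M\rangle, x^*)$ the program $B$ halts within time $q(|\langle n, M\rangle| + T)$ and outputs $p$. -/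

import Mathlib

namespace DMAC

/-! ### Grids, instances and violations -/

/-- The grid `{1, …, n}^d`, with the coordinatewise order. -/
abbrev Grid (n d : ℕ) : Type := Fin d → Set.Icc (1 : ℕ) n

/-- The distance of two grid points in the maximum norm. -/
def supDist {n d : ℕ} (x y : Grid n d) : ℕ :=
  Finset.univ.sup fun i => (((x i : ℕ) : ℤ) - ((y i : ℕ) : ℤ)).natAbs

/-- The instance `f` has no monotonicity violation (two points `x ≤ y` with `¬ f x ≤ f y`) and no
non-expansion violation (two points with `‖f x - f y‖ > ‖x - y‖` in the maximum norm). -/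
def ViolationFree {n d : ℕ} (f : Grid n d → Grid n d) : Prop :=
  (∀ x y, x ≤ y → f x ≤ f y) ∧ ∀ x y, supDist (f x) (f y) ≤ supDist x y

/-- The one-dimensional slice of the grid in dimension `i` through `x`. -/
def slice {n d : ℕ} (i : Fin d) (x : Grid n d) : Set (Grid n d) :=
  {y | ∀ j, j ≠ i → y j = x j}

/-- All displacements have length at most one in the maximum norm, and every one-dimensional slice
in every dimension `i` contains exactly one point that is fixed in dimension `i`. -/
def IsOneDUnique {n d : ℕ} (f : Grid n d → Grid n d) : Prop :=
  (∀ x, supDist x (f x) ≤ 1) ∧ ∀ x i, ∃! y, y ∈ slice i x ∧ f y i = y i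

/-! ### The machine model

Programs compute on binary trees. A run is charged for every elementary operation with the size of
the tree that the operation reads (and of the constant that it writes), so that the cost of a run
bounds the size of every tree that occurs in it. Costs in this model and running times of
multitape Turing machines bound each other polynomially (in the length of the program and the size
of the input), and programs are themselves inputs and outputs of programs through `Program.code`. -/

/-- Binary trees, the data of programs. -/
inductive Data : Type
  | nil : Data
  | cons : Data → Data → Data

/-- The number of nodes of a tree. -/
def Data.size : Data → ℕ
  | .nil => 1
  | .cons a b => a.size + b.size + 1

/-- The left subtree, `nil` for the empty tree. -/
def Data.left : Data → Data
  | .nil => .nil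
  | .cons a _ => a

/-- The right subtree, `nil` for the empty tree. -/
def Data.right : Data → Data
  | .nil => .nil
  | .cons _ b => b

/-- Programs; each denotes a partial function from trees to trees. -/
inductive Program : Type
  /-- output a constant -/
  | const : Data → Program
  /-- output the input -/
  | id : Program
  /-- output the left subtree of the input -/
  | left : Program
  /-- output the right subtree of the input -/
  | right : Program
  /-- run both programs on the input and output the pair of the results -/
  | pair : Program → Program → Program
  /-- run the first program on the input, and then the second on the result -/
  | seq : Program → Program → Program
  /-- run the second program on the input if the first outputs a nonempty tree, else the third -/
  | cond : Program → Program → Program → Program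
  /-- as long as the first program outputs a nonempty tree on the current value, replace the value
  by the output of the second program -/
  | loop : Program → Program → Program

/-- `Runs c v w t`: started on input `v`, the program `c` halts with output `w` after a run of
cost `t`. -/
inductive Runs : Program → Data → Data → ℕ → Prop
  | const (u v : Data) : Runs (.const u) v u (v.size + u.size)
  | id (v : Data) : Runs .id v v v.size
  | left (v : Data) : Runs .left v v.left v.size
  | right (v : Data) : Runs .right v v.right v.size
  | pair {c d : Program} {v a b : Data} {s t : ℕ} :
      Runs c v a s → Runs d v b t → Runs (.pair c d) v (.cons a b) (s + t + 1)
  | seq {c d : Program} {v a b : Data} {s t : ℕ} :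
      Runs c v a s → Runs d a b t → Runs (.seq c d) v b (s + t + 1)
  | cond_true {e c d : Program} {v x y a : Data} {s t : ℕ} :
      Runs e v (.cons x y) s → Runs c v a t → Runs (.cond e c d) v a (s + t + 1)
  | cond_false {e c d : Program} {v a : Data} {s t : ℕ} :
      Runs e v .nil s → Runs d v a t → Runs (.cond e c d) v a (s + t + 1)
  | loop_stop {e c : Program} {v : Data} {s : ℕ} :
      Runs e v .nil s → Runs (.loop e c) v v (s + 1)
  | loop_step {e c : Program} {v x y a b : Data} {s t r : ℕ} :
      Runs e v (.cons x y) s → Runs c v a t → Runs (.loop e c) a b r →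
      Runs (.loop e c) v b (s + t + r + 1)

/-- Runs are deterministic: output and cost are determined by program and input. -/
theorem Runs.det {c : Program} {v w w' : Data} {t t' : ℕ} (h : Runs c v w t)
    (h' : Runs c v w' t') : w = w' ∧ t = t' := by
  induction h generalizing w' t' with
  | const u v => cases h'; exact ⟨rfl, rfl⟩
  | id v => cases h'; exact ⟨rfl, rfl⟩
  | left v => cases h'; exact ⟨rfl, rfl⟩
  | right v => cases h'; exact ⟨rfl, rfl⟩
  | pair _ _ ih1 ih2 =>
    cases h' with
    | pair k1 k2 => obtain ⟨rfl, rfl⟩ := ih1 k1; obtain ⟨rfl, rfl⟩ := ih2 k2; exact ⟨rfl, rfl⟩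
  | seq _ _ ih1 ih2 =>
    cases h' with
    | seq k1 k2 => obtain ⟨rfl, rfl⟩ := ih1 k1; obtain ⟨rfl, rfl⟩ := ih2 k2; exact ⟨rfl, rfl⟩
  | cond_true _ _ ih1 ih2 =>
    cases h' with
    | cond_true k1 k2 =>
      obtain ⟨_, rfl⟩ := ih1 k1; obtain ⟨rfl, rfl⟩ := ih2 k2; exact ⟨rfl, rfl⟩
    | cond_false k1 _ => exact absurd (ih1 k1).1 (by simp)
  | cond_false _ _ ih1 ih2 =>
    cases h' with
    | cond_true k1 _ => exact absurd (ih1 k1).1 (by simp)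
    | cond_false k1 k2 =>
      obtain ⟨_, rfl⟩ := ih1 k1; obtain ⟨rfl, rfl⟩ := ih2 k2; exact ⟨rfl, rfl⟩
  | loop_stop _ ih1 =>
    cases h' with
    | loop_stop k1 => obtain ⟨_, rfl⟩ := ih1 k1; exact ⟨rfl, rfl⟩
    | loop_step k1 _ _ => exact absurd (ih1 k1).1 (by simp)
  | loop_step _ _ _ ih1 ih2 ih3 =>
    cases h' with
    | loop_stop k1 => exact absurd (ih1 k1).1 (by simp)
    | loop_step k1 k2 k3 =>
      obtain ⟨_, rfl⟩ := ih1 k1; obtain ⟨rfl, rfl⟩ := ih2 k2; obtain ⟨rfl, rfl⟩ := ih3 k3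
      exact ⟨rfl, rfl⟩

/-- Started on input `v`, the program `c` halts with output `w` within time `T`. -/
def RunsWithin (c : Program) (v w : Data) (T : ℕ) : Prop :=
  ∃ t ≤ T, Runs c v w t

/-! ### Encodings -/

/-- A list of bits as a tree. -/
def encBits : List Bool → Data
  | [] => .nil
  | false :: l => .cons .nil (encBits l)
  | true :: l => .cons (.cons .nil .nil) (encBits l)

/-- A natural number in binary, least significant bit first, as a tree. -/
def encNat (n : ℕ) : Data := encBits n.bits

/-- A point of a three-dimensional grid as a tree. -/
def encPoint {n : ℕ} (x : Grid n 3) : Data :=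
  .cons (encNat (x 0)) (.cons (encNat (x 1)) (encNat (x 2)))

/-- The source code of a program as a tree. -/
def Program.code : Program → Data
  | .const u => .cons (encNat 0) u
  | .id => .cons (encNat 1) .nil
  | .left => .cons (encNat 2) .nil
  | .right => .cons (encNat 3) .nil
  | .pair c d => .cons (encNat 4) (.cons c.code d.code)
  | .seq c d => .cons (encNat 5) (.cons c.code d.code)
  | .cond e c d => .cons (encNat 6) (.cons e.code (.cons c.code d.code))
  | .loop e c => .cons (encNat 7) (.cons e.code c.code)

/-- A three-dimensional instance as an input of programs: the length `n` of the grid, in binary,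
and a program for the function. -/
def encInstance (n : ℕ) (M : Program) : Data := .cons (encNat n) M.code

/-- The program `M` represents `f` with evaluation time `T`: on every point `x` of the grid it
outputs `f x` within time `T`. -/
def Represents {n : ℕ} (M : Program) (f : Grid n 3 → Grid n 3) (T : ℕ) : Prop :=
  ∀ x, RunsWithin M (encPoint x) (encPoint (f x)) T

end DMAC

/-! The interpolation averages `f` over the four integer points obtained by rounding down `x + t/4`
for `t = 0, …, 3`. Monotonicity and non-expansion let each component rise by at most one along this
chain. In quarter units the average is thus an integer `V = 4a + c`, where `a` is the first value
and `c` counts the thresholds with value `a + 1`; it is again monotone and non-expansive. As the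
index `k` stands for `(k - 1) / 4`, the equation `V = k` asks for a fixed point of the average
lowered by a quarter. The refined instance takes one unit step towards `V`.

Uniqueness rests on residues modulo four. `V i` grows under a step of at most one per coordinate
only if some increased coordinate `k j` rolls over at the threshold where the chain jumps, and then
`k j ≡ V i + 1` (`exists_of_interpolate_succ`). Hence, if `u` and `v` are fixed in dimension `i` and
`v i - u i = D > 0` is the largest displacement, some `j` has the same displacement and `u j ≡ u i +
1` (`exists_of_fixed_of_fixed`). On a slice `j = i`, which is absurd. For two fixed points the
argument iterates and would need four residues among three coordinates; this is why quarters suit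
dimension three.

Existence follows from monotonicity. The same count of residues excludes integer coordinates at a
fixed point, so rounding it up yields a fixed point of `f` (`fixed_corner`). Conversely, a fixed
point `p` of `f` gives the index `4p + 1`, which is mapped below itself and therefore bounds the
least fixed point of the refinement; so the rounded point is least.

For the time bounds, the source of `M` is pasted four times into a fixed frame of polynomial-time
binary arithmetic. -/

namespace DMAC

/-! ### Interpolation of integer functions on the quarter-integer grid -/

/-- A monotone function that grows by at most one under diagonal unit steps. -/
structure Interpolable (g : (Fin 3 → ℕ) → Fin 3 → ℕ) : Prop where
  mono : ∀ {v w}, v ≤ w → g v ≤ g w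
  le_add_one : ∀ {v w}, (∀ j, w j ≤ v j + 1) → ∀ i, g w i ≤ g v i + 1

/-- The corner of the unit cube around `k` that is selected by the threshold `t`. -/
def corner (t : ℕ) (k : Fin 3 → ℕ) : Fin 3 → ℕ := fun j => (k j + t - 1) / 4

/-- The interpolation of `g` along diagonal chains, in units of a quarter; the index `k` stands for
the coordinate `(k - 1) / 4`. -/
def interpolate (g : (Fin 3 → ℕ) → Fin 3 → ℕ) (k : Fin 3 → ℕ) (i : Fin 3) : ℕ :=
  g (corner 0 k) i + g (corner 1 k) i + g (corner 2 k) i + g (corner 3 k) i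

theorem corner_mono {s t : ℕ} {k l : Fin 3 → ℕ} (h : ∀ j, k j + s ≤ l j + t) :
    corner s k ≤ corner t l := fun j => by
  have := h j
  simp only [corner]
  omega

namespace Interpolable

variable {g : (Fin 3 → ℕ) → Fin 3 → ℕ}

theorem corner_le (hg : Interpolable g) {s t : ℕ} {k l : Fin 3 → ℕ}
    (h : ∀ j, k j + s ≤ l j + t) (i : Fin 3) : g (corner s k) i ≤ g (corner t l) i :=
  hg.mono (corner_mono h) i

theorem corner_le_add_one (hg : Interpolable g) (k : Fin 3 → ℕ) (i : Fin 3) :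
    g (corner 4 k) i ≤ g (corner 0 k) i + 1 :=
  hg.le_add_one (fun j => by simp only [corner]; omega) i

/-- The values of `g` on the chain of corners increase by at most one in total. -/
theorem chain (hg : Interpolable g) (k : Fin 3 → ℕ) (i : Fin 3) :
    g (corner 0 k) i ≤ g (corner 1 k) i ∧ g (corner 1 k) i ≤ g (corner 2 k) i ∧
    g (corner 2 k) i ≤ g (corner 3 k) i ∧ g (corner 3 k) i ≤ g (corner 4 k) i ∧
    g (corner 4 k) i ≤ g (corner 0 k) i + 1 :=
  ⟨hg.corner_le (fun _ => by omega) i, hg.corner_le (fun _ => by omega) i,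
    hg.corner_le (fun _ => by omega) i, hg.corner_le (fun _ => by omega) i,
    hg.corner_le_add_one k i⟩

theorem interpolate_mono (hg : Interpolable g) {k l : Fin 3 → ℕ} (h : k ≤ l) (i : Fin 3) :
    interpolate g k i ≤ interpolate g l i := by
  have H : ∀ t, g (corner t k) i ≤ g (corner t l) i := fun t =>
    hg.corner_le (fun j => Nat.add_le_add_right (h j) t) i
  have := H 0; have := H 1; have := H 2; have := H 3
  simp only [interpolate]
  omega

/-- A diagonal unit step shifts the thresholds from `0, …, 3` to `1, …, 4`. The sum changes by its
new last term minus its old first one, which is at most one. -/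
theorem interpolate_le_add (hg : Interpolable g) {k l : Fin 3 → ℕ} {c : ℕ}
    (h : ∀ j, l j ≤ k j + c) (i : Fin 3) : interpolate g l i ≤ interpolate g k i + c := by
  induction c generalizing l with
  | zero => exact hg.interpolate_mono h i
  | succ c ih =>
    have h1 : interpolate g (fun j => k j + c) i ≤ interpolate g k i + c := ih fun _ => le_rfl
    have H : ∀ t, g (corner t l) i ≤ g (corner (t + 1) (fun j => k j + c)) i := fun t =>
      hg.corner_le (fun j => by have := h j; omega) i
    have := H 0; have := H 1; have := H 2; have := H 3
    have := hg.chain (fun j => k j + c) i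
    norm_num only at *
    simp only [interpolate] at *
    omega

/-- If the chain of corners of `k` jumps at threshold `t`, some coordinate rolls over there. -/
theorem exists_of_corner_lt (hg : Interpolable g) {s t : ℕ} {k l : Fin 3 → ℕ} {i : Fin 3}
    (h : g (corner s k) i < g (corner t l) i) : ∃ j, (k j + s - 1) / 4 < (l j + t - 1) / 4 := by
  by_contra! H
  exact absurd (hg.mono (v := corner t l) (w := corner s k) H i) (not_le.2 h)

theorem exists_of_interpolate_succ (hg : Interpolable g) {k l : Fin 3 → ℕ} {i : Fin 3}
    (hk : ∀ j, 1 ≤ k j) (hkl : k ≤ l) (hlk : ∀ j, l j ≤ k j + 1)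
    (h : interpolate g l i = interpolate g k i + 1) :
    ∃ j, l j = k j + 1 ∧ (interpolate g k i + 1) % 4 = k j % 4 := by
  have H : ∀ t, g (corner t k) i ≤ g (corner t l) i := fun t =>
    hg.corner_le (fun j => Nat.add_le_add_right (hkl j) t) i
  have H' : ∀ t, g (corner t l) i ≤ g (corner (t + 1) k) i := fun t =>
    hg.corner_le (fun j => by have := hlk j; omega) i
  -- The chains of `k` and `l` interleave, so the growth happens at a `t` with the jump of the chain
  -- of `k` between `t` and `t + 1`. Exactly the thresholds `t + 1, …, 3` then carry the larger
  -- value, so the sum is `3 - t` modulo four.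
  have key : ∃ t < 4, g (corner t k) i < g (corner t l) i ∧
      (interpolate g k i + t) % 4 = 3 := by
    have := H 0; have := H 1; have := H 2; have := H 3
    have := H' 0; have := H' 1; have := H' 2; have := H' 3
    have := hg.chain k i
    norm_num only at *
    have : g (corner 0 k) i < g (corner 0 l) i ∨ g (corner 1 k) i < g (corner 1 l) i ∨
        g (corner 2 k) i < g (corner 2 l) i ∨ g (corner 3 k) i < g (corner 3 l) i := by
      simp only [interpolate] at h
      omega
    rcases this with h' | h' | h' | h'
    · exact ⟨0, by omega, h', by simp only [interpolate]; omega⟩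
    · exact ⟨1, by omega, h', by simp only [interpolate]; omega⟩
    · exact ⟨2, by omega, h', by simp only [interpolate]; omega⟩
    · exact ⟨3, by omega, h', by simp only [interpolate]; omega⟩
  obtain ⟨t, ht, h1, h2⟩ := key
  obtain ⟨j, hj⟩ := hg.exists_of_corner_lt h1
  -- Since `1 ≤ k j`, the truncated subtraction is exact, and the rollover means that four divides
  -- `k j + t`.
  have := hkl j; have := hlk j; have := hk j
  exact ⟨j, by omega, by omega⟩

/-- A value of the interpolation that is not an integer has the fractional part of a coordinate. -/
theorem exists_of_interpolate_mod (hg : Interpolable g) {k : Fin 3 → ℕ} {i : Fin 3}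
    (hk : ∀ j, 1 ≤ k j) (h : interpolate g k i % 4 ≠ 0) :
    ∃ j, k j % 4 = (interpolate g k i + 1) % 4 := by
  have key : ∃ t < 3, g (corner t k) i < g (corner (t + 1) k) i ∧
      (interpolate g k i + t) % 4 = 3 := by
    have := hg.chain k i
    have : g (corner 0 k) i < g (corner 1 k) i ∨ g (corner 1 k) i < g (corner 2 k) i ∨
        g (corner 2 k) i < g (corner 3 k) i := by
      simp only [interpolate] at h
      omega
    rcases this with h' | h' | h'
    · exact ⟨0, by omega, h', by simp only [interpolate]; omega⟩
    · exact ⟨1, by omega, h', by simp only [interpolate]; omega⟩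
    · exact ⟨2, by omega, h', by simp only [interpolate]; omega⟩
  obtain ⟨t, ht, h1, h2⟩ := key
  obtain ⟨j, hj⟩ := hg.exists_of_corner_lt h1
  have := hk j
  exact ⟨j, by omega⟩

/-- The engine of both uniqueness proofs: displacement `D` is passed on to a coordinate with the
next residue. -/
theorem exists_of_fixed_of_fixed (hg : Interpolable g) {u v : Fin 3 → ℕ} {D : ℕ} {i : Fin 3}
    (hD : 0 < D) (hu : ∀ j, 1 ≤ u j) (huv : ∀ j, v j ≤ u j + D) (hi : v i = u i + D)
    (hfu : interpolate g u i = u i) (hfv : interpolate g v i = v i) :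
    ∃ j, v j = u j + D ∧ (u i + 1) % 4 = u j % 4 := by
  -- Lowering `v` diagonally by `D - 1` costs at most `D - 1` in value, so `z` lies within one step
  -- above `u` and still has a larger value.
  set z : Fin 3 → ℕ := fun j => max (u j) (v j - (D - 1)) with hz
  have h1 : interpolate g v i ≤ interpolate g z i + (D - 1) :=
    hg.interpolate_le_add (fun j => by simp only [hz]; omega) i
  have hzu : ∀ j, z j ≤ u j + 1 := fun j => by have := huv j; simp only [hz]; omega
  have h2 := hg.interpolate_le_add hzu i
  obtain ⟨j, hj, hj'⟩ := hg.exists_of_interpolate_succ (k := u) (l := z) (i := i) hu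
    (fun j => le_max_left _ _) hzu (by omega)
  refine ⟨j, ?_, by rw [← hfu]; exact hj'⟩
  have := huv j
  simp only [hz] at hj
  omega

end Interpolable

/-- No point of `Fin 3 → ℕ` has coordinates of all four residues modulo four. -/
theorem not_all_residues (k : Fin 3 → ℕ) (P : Fin 3 → Prop) {i : Fin 3} (hi : P i)
    (h : ∀ i, P i → ∃ j, P j ∧ (k i + 1) % 4 = k j % 4) : False := by
  -- Three applications of `h` produce four successive residues, hence four distinct elements of
  -- `Fin 3`.
  obtain ⟨j, hj, h1⟩ := h i hi
  obtain ⟨l, hl, h2⟩ := h j hj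
  obtain ⟨m, -, h3⟩ := h l hl
  have hij : i ≠ j := by rintro rfl; omega
  have hil : i ≠ l := by rintro rfl; omega
  have him : i ≠ m := by rintro rfl; omega
  have hjl : j ≠ l := by rintro rfl; omega
  have hjm : j ≠ m := by rintro rfl; omega
  have hlm : l ≠ m := by rintro rfl; omega
  omega

/-- The coordinates of a fixed point of the interpolation lie strictly above a corner. -/
theorem Interpolable.fixed_mod_ne {g : (Fin 3 → ℕ) → Fin 3 → ℕ} (hg : Interpolable g)
    {k : Fin 3 → ℕ} (hk : ∀ j, 1 ≤ k j) (h : ∀ j, interpolate g k j = k j) (i : Fin 3) :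
    k i % 4 ≠ 1 := by
  intro h0
  -- Residue 1 forces 2, then 3, then 0 among the coordinates, and these are too many.
  obtain ⟨j, hj⟩ := hg.exists_of_interpolate_mod (i := i) hk (by rw [h]; omega)
  obtain ⟨l, hl⟩ := hg.exists_of_interpolate_mod (i := j) hk (by rw [h] at hj ⊢; omega)
  obtain ⟨m, hm⟩ := hg.exists_of_interpolate_mod (i := l) hk (by rw [h] at hl hj ⊢; omega)
  rw [h] at hj hl hm
  have hij : i ≠ j := by rintro rfl; omega
  have hil : i ≠ l := by rintro rfl; omega
  have him : i ≠ m := by rintro rfl; omega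
  have hjl : j ≠ l := by rintro rfl; omega
  have hjm : j ≠ m := by rintro rfl; omega
  have hlm : l ≠ m := by rintro rfl; omega
  omega

/-- Write `k i = 4a + c` as value of the interpolation. Rounding up agrees with the value at `corner
3` except for `c = 1`, the residue excluded by `fixed_mod_ne`. -/
theorem Interpolable.fixed_corner {g : (Fin 3 → ℕ) → Fin 3 → ℕ} (hg : Interpolable g)
    {k : Fin 3 → ℕ} (hk : ∀ j, 1 ≤ k j) (h : ∀ j, interpolate g k j = k j) :
    g (corner 3 k) = corner 3 k := by
  funext i
  have h1 := hg.fixed_mod_ne hk h i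
  have h2 := h i
  have := hg.chain k i
  have h3 : corner 3 k i = (k i + 2) / 4 := rfl
  have := hk i
  rw [h3]
  simp only [interpolate] at h2
  omega

/-! ### The refined instance -/

/-- Clamping to the interval `[1, n]`. -/
def clamp (n v : ℕ) : ℕ := max 1 (min v n)

theorem clamp_mem {n : ℕ} (hn : 1 ≤ n) (v : ℕ) : clamp n v ∈ Set.Icc 1 n := by
  simp only [clamp, Set.mem_Icc]
  omega

/-- The grid point closest to `v`. -/
def clampPoint {n : ℕ} (hn : 1 ≤ n) (v : Fin 3 → ℕ) : Grid n 3 :=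
  fun j => ⟨clamp n (v j), clamp_mem hn _⟩

/-- The extension of an instance to all of `ℕ³`. -/
def extend {n : ℕ} (hn : 1 ≤ n) (f : Grid n 3 → Grid n 3) (v : Fin 3 → ℕ) (i : Fin 3) : ℕ :=
  f (clampPoint hn v) i

theorem supDist_le {n d : ℕ} {x y : Grid n d} {D : ℕ} :
    supDist x y ≤ D ↔ ∀ i, (y i : ℕ) ≤ x i + D ∧ (x i : ℕ) ≤ y i + D := by
  simp only [supDist, Finset.sup_le_iff, Finset.mem_univ, true_imp_iff]
  exact forall_congr' fun i => by omega

theorem interpolable_extend {n : ℕ} (hn : 1 ≤ n) {f : Grid n 3 → Grid n 3}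
    (hf : ViolationFree f) : Interpolable (extend hn f) where
  mono {v w} h i := hf.1 _ _ (fun j => by
    have : v j ≤ w j := h j
    show clamp n (v j) ≤ clamp n (w j)
    simp only [clamp]
    omega) i
  le_add_one {v w} h i := by
    -- The point `w` may lie far below `v` in some coordinates, where non-expansion says too little.
    -- The join is within one of `v`, and monotonicity covers the rest.
    have h1 : f (clampPoint hn w) ≤ f (clampPoint hn v ⊔ clampPoint hn w) := hf.1 _ _ le_sup_right
    have h2 : supDist (clampPoint hn v) (clampPoint hn v ⊔ clampPoint hn w) ≤ 1 := by
      refine supDist_le.2 fun j => ?_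
      have := h j
      have h3 : ((clampPoint hn v ⊔ clampPoint hn w) j : ℕ) =
          max (clamp n (v j)) (clamp n (w j)) := by
        rw [Pi.sup_apply]
        exact (Subtype.mono_coe _).map_sup _ _
      have h4 : (clampPoint hn v j : ℕ) = clamp n (v j) := rfl
      rw [h3, h4]
      simp only [clamp]
      omega
    exact le_trans (Subtype.coe_le_coe.2 (h1 i)) (supDist_le.1 ((hf.2 _ _).trans h2) i).1

theorem interpolate_extend_mem {n : ℕ} (hn : 1 ≤ n) (f : Grid n 3 → Grid n 3)
    (k : Fin 3 → ℕ) (i : Fin 3) :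
    4 ≤ interpolate (extend hn f) k i ∧ interpolate (extend hn f) k i ≤ 4 * n := by
  have H : ∀ v, 1 ≤ extend hn f v i ∧ extend hn f v i ≤ n := fun v => (f (clampPoint hn v) i).2
  have := H (corner 0 k); have := H (corner 1 k); have := H (corner 2 k); have := H (corner 3 k)
  simp only [interpolate]
  omega

/-- One unit step from `k` in the direction of `F`. -/
def stepToward (k F : ℕ) : ℕ := if k < F then k + 1 else if F < k then k - 1 else k

/-- The coordinates of a grid point. -/
def coords {n : ℕ} (x : Grid n 3) : Fin 3 → ℕ := fun j => x j

/-- The refined instance: one unit step towards the interpolation. -/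
def refinement {n : ℕ} (hn : 1 ≤ n) (f : Grid n 3 → Grid n 3) (x : Grid (4 * n + 5) 3) :
    Grid (4 * n + 5) 3 := fun i =>
  ⟨stepToward (x i) (interpolate (extend hn f) (coords x) i), by
    have := interpolate_extend_mem hn f (coords x) i
    have := (x i).2
    simp only [Set.mem_Icc, stepToward] at *
    split_ifs <;> omega⟩

theorem refinement_apply_eq_iff {n : ℕ} (hn : 1 ≤ n) {f : Grid n 3 → Grid n 3}
    (x : Grid (4 * n + 5) 3) (i : Fin 3) :
    refinement hn f x i = x i ↔ interpolate (extend hn f) (coords x) i = coords x i := by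
  have := (x i).2.1
  rw [Subtype.ext_iff]
  simp only [refinement, stepToward, coords]
  split_ifs <;> omega

theorem refinement_fixed_iff {n : ℕ} (hn : 1 ≤ n) {f : Grid n 3 → Grid n 3}
    (x : Grid (4 * n + 5) 3) :
    Function.IsFixedPt (refinement hn f) x ↔
      ∀ i, interpolate (extend hn f) (coords x) i = coords x i := by
  simp only [Function.IsFixedPt, funext_iff, refinement_apply_eq_iff]

/-- Opposite unit steps could only reverse equal or adjacent coordinates, and the order of the
targets rules this out. -/
theorem monotone_refinement {n : ℕ} (hn : 1 ≤ n) {f : Grid n 3 → Grid n 3}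
    (hf : ViolationFree f) : Monotone (refinement hn f) := by
  intro x y h i
  have h1 := (interpolable_extend hn hf).interpolate_mono (k := coords x) (l := coords y) h i
  have h2 : (x i : ℕ) ≤ y i := h i
  show stepToward _ _ ≤ stepToward _ _
  simp only [stepToward]
  split_ifs <;> omega

theorem violationFree_refinement {n : ℕ} (hn : 1 ≤ n) {f : Grid n 3 → Grid n 3}
    (hf : ViolationFree f) : ViolationFree (refinement hn f) := by
  refine ⟨fun x y h => monotone_refinement hn hf h, fun x y => supDist_le.2 fun i => ?_⟩
  have hd := supDist_le.1 (le_refl (supDist x y))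
  have h1 := (interpolable_extend hn hf).interpolate_le_add (k := coords x) (l := coords y)
    (fun j => (hd j).1) i
  have h2 := (interpolable_extend hn hf).interpolate_le_add (k := coords y) (l := coords x)
    (fun j => (hd j).2) i
  have := hd i
  simp only [refinement, stepToward]
  constructor <;> split_ifs <;> omega

theorem isOneDUnique_refinement {n : ℕ} (hn : 1 ≤ n) {f : Grid n 3 → Grid n 3}
    (hf : ViolationFree f) : IsOneDUnique (refinement hn f) := by
  refine ⟨fun x => supDist_le.2 fun i => ?_, fun x i => ?_⟩
  · simp only [refinement, stepToward]
    split_ifs <;> omega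
  have hg := interpolable_extend hn hf
  have hmem : ∀ x : Grid (4 * n + 5) 3, ∀ j, 1 ≤ coords x j := fun x j => (x j).2.1
  -- Only coordinate `i` varies on the slice, so the coordinate with the next residue would be `i`
  -- itself.
  have uniq : ∀ y z : Grid (4 * n + 5) 3, y ∈ slice i x → z ∈ slice i x →
      refinement hn f y i = y i → refinement hn f z i = z i → ¬ (y i : ℕ) < z i := by
    intro y z hy hz hfy hfz hlt
    obtain ⟨j, hj, hj'⟩ := hg.exists_of_fixed_of_fixed (u := coords y) (v := coords z)
      (D := (z i : ℕ) - y i) (i := i) (by omega) (hmem y) (fun j => by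
        by_cases hji : j = i
        · subst hji; simp only [coords]; omega
        · simp only [coords, hy j hji, hz j hji]; omega)
      (by simp only [coords]; omega) ((refinement_apply_eq_iff hn y i).1 hfy)
      ((refinement_apply_eq_iff hn z i).1 hfz)
    have hji : j = i := by
      by_contra hji
      simp only [coords, hy j hji, hz j hji] at hj
      omega
    subst hji
    omega
  set φ : ℕ → ℕ := fun t => interpolate (extend hn f) (Function.update (coords x) i t) i with hφ
  have hφm : ∀ {s t}, s ≤ t → φ s ≤ φ t := fun {s t} hst =>
    hg.interpolate_mono (update_le_update_iff.2 ⟨hst, fun _ _ => le_rfl⟩) i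
  have hφr : ∀ t, 4 ≤ φ t ∧ φ t ≤ 4 * n := fun t => interpolate_extend_mem hn f _ i
  -- The least such `t` is fixed: minimality gives `t ≤ φ (t - 1) ≤ φ t`, where `4 ≤ φ t ≤ t` keeps
  -- `t` positive.
  have hex : ∃ t, φ t ≤ t := ⟨4 * n, (hφr _).2⟩
  classical
  have ht := Nat.find_spec hex
  have hmin : ∀ s < Nat.find hex, s < φ s := fun s hs => not_le.1 (Nat.find_min hex hs)
  have hle : Nat.find hex ≤ 4 * n := Nat.find_min' hex (hφr _).2
  set t := Nat.find hex
  have h4 := hφr t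
  have hfix : φ t = t := by
    have h1 := hmin (t - 1) (by omega)
    have h2 := hφm (Nat.sub_le t 1)
    omega
  let y : Grid (4 * n + 5) 3 := Function.update x i ⟨t, by constructor <;> omega⟩
  have hyc : coords y = Function.update (coords x) i t := by
    funext j
    by_cases hji : j = i
    · subst hji; simp [coords, y]
    · simp [coords, y, hji]
  have hyf : refinement hn f y i = y i := by
    rw [refinement_apply_eq_iff, hyc]
    simpa [hφ] using hfix
  have hys : y ∈ slice i x := fun j hj => Function.update_of_ne hj _ _
  refine ⟨y, ⟨hys, hyf⟩, fun z ⟨hzs, hzf⟩ => ?_⟩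
  funext j
  by_cases hji : j = i
  · subst hji
    have h1 := uniq y z hys hzs hyf hzf
    have h2 := uniq z y hzs hys hzf hyf
    exact Subtype.ext (by omega)
  · rw [hzs j hji, hys j hji]

/-- The refined instance has exactly one fixed point, and rounding it up gives the least fixed point
of the instance. -/
theorem exists_fixed_refinement {n : ℕ} (hn : 1 ≤ n) {f : Grid n 3 → Grid n 3}
    (hf : ViolationFree f) : ∃ x : Grid (4 * n + 5) 3,
    (∀ y, Function.IsFixedPt (refinement hn f) y ↔ y = x) ∧
    ∃ p : Grid n 3, (∀ i, (p i : ℕ) = ((x i : ℕ) + 2) / 4) ∧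
      IsLeast (Function.fixedPoints f) p := by
  have hg := interpolable_extend hn hf
  -- A nonempty interval makes the grid a complete lattice, as Knaster–Tarski requires.
  have : Fact (1 ≤ 4 * n + 5) := ⟨by omega⟩
  let F : Grid (4 * n + 5) 3 →o Grid (4 * n + 5) 3 := ⟨refinement hn f, monotone_refinement hn hf⟩
  set x : Grid (4 * n + 5) 3 := F.lfp with hx
  have hxf : Function.IsFixedPt (refinement hn f) x := F.map_lfp
  have hxi := (refinement_fixed_iff hn x).1 hxf
  have hx1 : ∀ j, 1 ≤ coords x j := fun j => (x j).2.1
  have hc := hg.fixed_corner hx1 hxi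
  refine ⟨x, fun y => ⟨fun hy => ?_, fun h => h ▸ hxf⟩, f (clampPoint hn (corner 3 (coords x))),
    fun i => congrFun hc i, ?_, ?_⟩
  · have hle : x ≤ y := F.lfp_le (le_of_eq hy)
    have hyi := (refinement_fixed_iff hn y).1 hy
    by_contra hne
    obtain ⟨i, -, hi⟩ := Finset.exists_max_image Finset.univ
      (fun j => (y j : ℕ) - x j) Finset.univ_nonempty
    have hle' : ∀ j, (x j : ℕ) ≤ y j := hle
    have hD : 0 < (y i : ℕ) - x i := by
      by_contra h0
      refine hne (funext fun j => Subtype.ext ?_)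
      have := hi j (Finset.mem_univ _)
      have := hle' j
      omega
    -- The predicate selects the coordinates of maximal displacement.
    refine not_all_residues (coords x) (fun j => (y j : ℕ) = x j + ((y i : ℕ) - x i)) (i := i)
      (by omega) fun j hj => ?_
    exact hg.exists_of_fixed_of_fixed (u := coords x) (v := coords y) hD hx1 (fun l => by
      have := hi l (Finset.mem_univ _)
      simp only [coords]; omega) hj (hxi j) (hyi j)
  · have : clampPoint hn (corner 3 (coords x)) = f (clampPoint hn (corner 3 (coords x))) := by
      funext j
      refine Subtype.ext ?_
      have h1 : (f (clampPoint hn (corner 3 (coords x))) j : ℕ) = corner 3 (coords x) j :=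
        congrFun hc j
      have h2 := (f (clampPoint hn (corner 3 (coords x))) j).2
      rw [Set.mem_Icc] at h2
      rw [h1] at h2 ⊢
      simp only [clampPoint, clamp]
      omega
    exact congrArg f this.symm
  · intro p hp
    have hp2 : ∀ j, 1 ≤ (p j : ℕ) ∧ (p j : ℕ) ≤ n := fun j => (p j).2
    -- The index of the coordinate `p j`. All four corners equal `p`, so the target `4 * p j` is one
    -- below `y j`, and `y` is mapped below itself.
    let y : Grid (4 * n + 5) 3 := fun j => ⟨4 * p j + 1, by
      have := hp2 j
      constructor <;> omega⟩
    have hcor : ∀ t < 4, clampPoint hn (corner t (coords y)) = p := fun t ht => by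
      funext j
      refine Subtype.ext ?_
      have := hp2 j
      simp only [clampPoint, clamp, corner, coords, y]
      omega
    have hxy : x ≤ y := F.lfp_le fun j => by
      have h1 : ∀ t < 4, extend hn f (corner t (coords y)) j = p j := fun t ht => by
        rw [extend, hcor t ht, show f p = p from hp]
      have h2 : interpolate (extend hn f) (coords y) j = 4 * p j := by
        rw [interpolate, h1 0 (by omega), h1 1 (by omega), h1 2 (by omega), h1 3 (by omega)]
        omega
      show stepToward (4 * p j + 1) (interpolate (extend hn f) (coords y) j) ≤ 4 * p j + 1
      rw [h2, stepToward]
      split_ifs <;> omega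
    intro j
    have h1 : (f (clampPoint hn (corner 3 (coords x))) j : ℕ) = ((x j : ℕ) + 2) / 4 :=
      congrFun hc j
    have h2 : (x j : ℕ) ≤ 4 * p j + 1 := hxy j
    show (f (clampPoint hn (corner 3 (coords x))) j : ℕ) ≤ p j
    omega

/-! ### Time bounds -/

theorem eval_mono (q : Polynomial ℕ) {a b : ℕ} (h : a ≤ b) : q.eval a ≤ q.eval b := by
  induction q using Polynomial.induction_on' with
  | add p q hp hq => simp only [Polynomial.eval_add]; omega
  | monomial k c =>
    simp only [Polynomial.eval_monomial]
    exact Nat.mul_le_mul_left _ (Nat.pow_le_pow_left h _)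

theorem Data.size_pos (v : Data) : 1 ≤ v.size := by
  cases v <;> simp [Data.size]

theorem Data.size_left_le (v : Data) : v.left.size ≤ v.size := by
  cases v <;> simp only [Data.left, Data.size] <;> omega

theorem Data.size_right_le (v : Data) : v.right.size ≤ v.size := by
  cases v <;> simp only [Data.right, Data.size] <;> omega

theorem Runs.input_size_le {c : Program} {v w : Data} {t : ℕ} (h : Runs c v w t) :
    v.size ≤ t := by
  induction h <;> omega

theorem Runs.output_size_le {c : Program} {v w : Data} {t : ℕ} (h : Runs c v w t) :
    w.size ≤ t := by
  induction h with
  | const u v => omega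
  | id v => exact le_rfl
  | left v => exact v.size_left_le
  | right v => exact v.size_right_le
  | pair _ _ h1 h2 => simp only [Data.size]; omega
  | loop_stop h h1 => have := h.input_size_le; omega
  | seq | cond_true | cond_false | loop_step => omega

namespace RunsWithin

variable {c d e : Program} {u v w : Data} {S T : ℕ}

theorem mono (h : RunsWithin c v w S) (hST : S ≤ T) : RunsWithin c v w T :=
  let ⟨t, ht, hr⟩ := h
  ⟨t, ht.trans hST, hr⟩

theorem output_size_le (h : RunsWithin c v w T) : w.size ≤ T :=
  let ⟨_, ht, hr⟩ := h
  hr.output_size_le.trans ht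

theorem pair (hc : RunsWithin c v u S) (hd : RunsWithin d v w T) :
    RunsWithin (.pair c d) v (.cons u w) (S + T + 1) :=
  let ⟨_, hs, hc⟩ := hc
  let ⟨_, ht, hd⟩ := hd
  ⟨_, by omega, hc.pair hd⟩

theorem seq (hc : RunsWithin c v u S) (hd : RunsWithin d u w T) :
    RunsWithin (.seq c d) v w (S + T + 1) :=
  let ⟨_, hs, hc⟩ := hc
  let ⟨_, ht, hd⟩ := hd
  ⟨_, by omega, hc.seq hd⟩

end RunsWithin

/-! ### Polynomial-time functions between encoded types -/

/-- Types whose elements are encoded as trees. -/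
class Enc (α : Type) where
  /-- the encoding -/
  enc : α → Data

open Enc (enc)

instance : Enc Data := ⟨fun u => u⟩
instance : Enc Bool := ⟨fun b => if b then .cons .nil .nil else .nil⟩
instance : Enc ℕ := ⟨encNat⟩
instance : Enc Program := ⟨Program.code⟩
instance {α β : Type} [Enc α] [Enc β] : Enc (α × β) := ⟨fun x => .cons (enc x.1) (enc x.2)⟩

/-- The size of an encoded object. -/
def encSize {α : Type} [Enc α] (a : α) : ℕ := (enc a).size

theorem encSize_prod {α β : Type} [Enc α] [Enc β] (a : α) (b : β) :
    encSize (a, b) = encSize a + encSize b + 1 := rfl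

theorem encSize_pos {α : Type} [Enc α] (a : α) : 1 ≤ encSize a := Data.size_pos _

/-- Some program computes `f` in polynomial time. -/
def PolyTime {α β : Type} [Enc α] [Enc β] (f : α → β) : Prop :=
  ∃ (c : Program) (q : Polynomial ℕ), ∀ a, RunsWithin c (enc a) (enc (f a)) (q.eval (encSize a))

namespace PolyTime

variable {α β γ : Type} [Enc α] [Enc β] [Enc γ]

theorem id : PolyTime (fun a : α => a) :=
  ⟨.id, Polynomial.X, fun a => ⟨_, by simp [encSize], .id _⟩⟩

theorem const (b : β) : PolyTime (fun _ : α => b) :=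
  ⟨.const (enc b), Polynomial.X + Polynomial.C (enc b).size, fun a =>
    ⟨_, by simp [encSize], .const _ _⟩⟩

theorem pair {f : α → β} {g : α → γ} (hf : PolyTime f) (hg : PolyTime g) :
    PolyTime (fun a => (f a, g a)) :=
  let ⟨c, p, hc⟩ := hf
  let ⟨d, q, hd⟩ := hg
  ⟨.pair c d, p + q + 1, fun a => by
    simp only [Polynomial.eval_add, Polynomial.eval_one]
    exact (hc a).pair (hd a)⟩

theorem comp {g : β → γ} {f : α → β} (hg : PolyTime g) (hf : PolyTime f) :
    PolyTime (fun a => g (f a)) :=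
  let ⟨c, p, hc⟩ := hf
  let ⟨d, q, hd⟩ := hg
  ⟨.seq c d, p + q.comp p + 1, fun a => by
    simpa only [Polynomial.eval_add, Polynomial.eval_one, Polynomial.eval_comp] using
      (hc a).seq ((hd (f a)).mono (eval_mono q (hc a).output_size_le))⟩

theorem of_enc {f : α → β} {g : α → γ} (hg : PolyTime g) (h : ∀ a, enc (f a) = enc (g a)) :
    PolyTime f :=
  let ⟨c, q, hc⟩ := hg
  ⟨c, q, fun a => (h a).symm ▸ hc a⟩

theorem exists_encSize_le {f : α → β} (hf : PolyTime f) :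
    ∃ q : Polynomial ℕ, ∀ a, encSize (f a) ≤ q.eval (encSize a) :=
  let ⟨_, q, hc⟩ := hf
  ⟨q, fun a => (hc a).output_size_le⟩

theorem fst {f : α → β × γ} (hf : PolyTime f) : PolyTime (fun a => (f a).1) :=
  comp (g := Prod.fst)
    ⟨.left, Polynomial.X, fun x => ⟨_, by simp [encSize], Runs.left (enc x)⟩⟩ hf

theorem snd {f : α → β × γ} (hf : PolyTime f) : PolyTime (fun a => (f a).2) :=
  comp (g := Prod.snd)
    ⟨.right, Polynomial.X, fun x => ⟨_, by simp [encSize], Runs.right (enc x)⟩⟩ hf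

theorem ite {t : α → Bool} {f g : α → β} (ht : PolyTime t) (hf : PolyTime f) (hg : PolyTime g) :
    PolyTime (fun a => if t a then f a else g a) :=
  let ⟨e, r, he⟩ := ht
  let ⟨c, p, hc⟩ := hf
  let ⟨d, q, hd⟩ := hg
  ⟨.cond e c d, r + p + q + 1, fun a => by
    obtain ⟨t₁, h₁, he⟩ := he a
    obtain ⟨t₂, h₂, hc⟩ := hc a
    obtain ⟨t₃, h₃, hd⟩ := hd a
    simp only [Polynomial.eval_add, Polynomial.eval_one]
    cases h : t a
    · rw [h] at he
      exact ⟨_, by omega, .cond_false he hd⟩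
    · rw [h] at he
      exact ⟨_, by omega, .cond_true he hc⟩⟩

/-- A loop runs in polynomial time if a measure bounded by the size of the state decreases in every
step and no step increases the size of the state by more than a constant. -/
theorem loop {t : α → Bool} {s r : α → α} (ht : PolyTime t) (hs : PolyTime s) (μ : α → ℕ) (C : ℕ)
    (hμ : ∀ a, μ a ≤ encSize a) (hexit : ∀ a, t a = false → r a = a)
    (hstep : ∀ a, t a = true → r (s a) = r a ∧ μ (s a) < μ a ∧ encSize (s a) ≤ encSize a + C) :
    PolyTime r := by
  obtain ⟨e, p, he⟩ := ht
  obtain ⟨c, q, hc⟩ := hs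
  -- `S` bounds the size of every state still to come: the drop of the measure pays for the growth
  -- by `C`, so one cost bound serves all passes.
  have key : ∀ (m : ℕ) (a : α) (S : ℕ), μ a ≤ m → encSize a + C * m ≤ S →
      RunsWithin (.loop e c) (enc a) (enc (r a)) ((m + 1) * (p.eval S + q.eval S + 1)) := by
    intro m
    induction m with
    | zero =>
      intro a S hm hS
      obtain ⟨t₁, h₁, he⟩ := he a
      have hta : t a = false := by
        by_contra h
        have := hstep a (by simpa using h)
        omega
      rw [hta] at he
      rw [hexit a hta]
      have := eval_mono p (show encSize a ≤ S by omega)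
      exact ⟨_, by omega, Runs.loop_stop he⟩
    | succ m ih =>
      intro a S hm hS
      obtain ⟨t₁, h₁, he⟩ := he a
      obtain ⟨t₂, h₂, hc⟩ := hc a
      have h3 := eval_mono p (show encSize a ≤ S by omega)
      have h4 := eval_mono q (show encSize a ≤ S by omega)
      rw [Nat.add_mul (m + 1) 1, Nat.one_mul]
      cases hta : t a
      · rw [hta] at he
        rw [hexit a hta]
        exact ⟨_, by omega, Runs.loop_stop he⟩
      · rw [hta] at he
        obtain ⟨h5, h6, h7⟩ := hstep a hta
        rw [Nat.mul_succ] at hS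
        obtain ⟨t₃, h₈, hl⟩ := ih (s a) S (by omega) (by omega)
        rw [h5] at hl
        exact ⟨_, by omega, .loop_step he hc hl⟩
  refine ⟨.loop e c, (Polynomial.X + 1) *
    ((p + q + 1).comp (Polynomial.X + Polynomial.C C * Polynomial.X)), fun a => ?_⟩
  simpa using key (encSize a) a _ (hμ a) le_rfl

/-! ### Programs as outputs -/

/-- Source code is a numeral paired with the codes of the parts, so assembling programs amounts to
pairing. -/
theorem progSeq {f g : α → Program} (hf : PolyTime f) (hg : PolyTime g) :
    PolyTime (fun a => Program.seq (f a) (g a)) :=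
  of_enc (pair (const (5 : ℕ)) (pair hf hg)) fun _ => rfl

theorem progPair {f g : α → Program} (hf : PolyTime f) (hg : PolyTime g) :
    PolyTime (fun a => Program.pair (f a) (g a)) :=
  of_enc (pair (const (4 : ℕ)) (pair hf hg)) fun _ => rfl

theorem progConst {f : α → β} (hf : PolyTime f) :
    PolyTime (fun a => Program.const (enc (f a))) :=
  of_enc (pair (const (0 : ℕ)) hf) fun _ => rfl

end PolyTime

/-! ### Binary arithmetic -/

theorem encNat_cons {n : ℕ} (h : n ≠ 0) :
    encNat n = .cons (enc (decide (n % 2 = 1))) (encNat (n / 2)) := by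
  have h1 : n = Nat.bit (decide (n % 2 = 1)) (n / 2) := by
    simp only [Nat.bit]
    rcases Nat.mod_two_eq_zero_or_one n with h2 | h2 <;> simp [h2] <;> omega
  conv_lhs => rw [encNat, h1, Nat.bits_append_bit _ _ (fun h2 => by simp; omega)]
  cases decide (n % 2 = 1) <;> rfl

theorem encSize_zero : encSize 0 = 1 := rfl

theorem encSize_bool (b : Bool) : 1 ≤ encSize b ∧ encSize b ≤ 3 := by
  cases b <;> decide

theorem encSize_nat {n : ℕ} (h : n ≠ 0) :
    encSize (n / 2) + 2 ≤ encSize n ∧ encSize n ≤ encSize (n / 2) + 4 := by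
  have h1 : encSize n = encSize (decide (n % 2 = 1)) + encSize (n / 2) + 1 :=
    congrArg Data.size (encNat_cons h)
  have := encSize_bool (decide (n % 2 = 1))
  omega

theorem encSize_two_mul_le (n : ℕ) : encSize (2 * n) ≤ encSize n + 4 := by
  rcases Nat.eq_zero_or_pos n with rfl | h
  · decide
  · simpa using (encSize_nat (n := 2 * n) (by omega)).2

theorem encSize_two_mul_add_one_le (n : ℕ) : encSize (2 * n + 1) ≤ encSize n + 4 := by
  simpa [Nat.mul_add_div] using (encSize_nat (n := 2 * n + 1) (by omega)).2

/-- A bit 0 costs two nodes and a bit 1 costs four, so a smaller number can have a larger tree, but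
at most twice as large. -/
theorem encSize_le_of_le {m n : ℕ} (h : m ≤ n) : encSize m ≤ 2 * encSize n := by
  induction m using Nat.strong_induction_on generalizing n with
  | _ m ih =>
    rcases Nat.eq_zero_or_pos m with rfl | hm
    · have := encSize_pos n
      rw [encSize_zero]
      omega
    · have := ih (m / 2) (by omega) (n := n / 2) (by omega)
      have := encSize_nat (n := m) (by omega)
      have := encSize_nat (n := n) (by omega)
      omega

namespace PolyTime

variable {α : Type} [Enc α] {f g : α → ℕ}

theorem ne_zero (hf : PolyTime f) : PolyTime (fun a => decide (f a ≠ 0)) :=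
  comp (g := fun n : ℕ => decide (n ≠ 0)) (f := f)
    ⟨.cond .id (.const (enc true)) (.const (enc false)),
      Polynomial.X + (Polynomial.X + 3) + 1, fun n => by
      simp only [Polynomial.eval_add, Polynomial.eval_X, Polynomial.eval_one,
        Polynomial.eval_ofNat]
      have h1 := Runs.id (enc n)
      by_cases h : n = 0
      · subst h
        exact ⟨_, by decide, .cond_false h1 (.const _ _)⟩
      · rw [decide_eq_true h]
        nth_rw 2 [show enc n = _ from encNat_cons h] at h1
        exact ⟨_, le_rfl, .cond_true h1 (.const _ _)⟩⟩ hf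

theorem odd (hf : PolyTime f) : PolyTime (fun a => decide (f a % 2 = 1)) :=
  comp (g := fun n : ℕ => decide (n % 2 = 1)) (f := f)
    ⟨.left, Polynomial.X, fun n => by
      have h1 := Runs.left (enc n)
      have h2 : (enc n).left = enc (decide (n % 2 = 1)) := by
        by_cases h : n = 0
        · subst h; rfl
        · rw [show enc n = _ from encNat_cons h]; rfl
      rw [h2] at h1
      exact ⟨_, by simp [encSize], h1⟩⟩ hf

theorem half (hf : PolyTime f) : PolyTime (fun a => f a / 2) :=
  comp (g := fun n : ℕ => n / 2) (f := f)
    ⟨.right, Polynomial.X, fun n => by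
      have h1 := Runs.right (enc n)
      have h2 : (enc n).right = enc (n / 2) := by
        by_cases h : n = 0
        · subst h; rfl
        · rw [show enc n = _ from encNat_cons h]; rfl
      rw [h2] at h1
      exact ⟨_, by simp [encSize], h1⟩⟩ hf

theorem two_mul_add_one (hf : PolyTime f) : PolyTime (fun a => 2 * f a + 1) :=
  of_enc (pair (const true) hf) fun a => (encNat_cons (by omega)).trans (by
    rw [show (2 * f a + 1) / 2 = f a by omega, decide_eq_true (by omega)]; rfl)

theorem two_mul (hf : PolyTime f) : PolyTime (fun a => 2 * f a) := by
  have h : PolyTime (fun a => enc (false, f a)) := of_enc (pair (const false) hf) fun _ => rfl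
  -- Zero is the empty tree; prepending a bit 0 to it would not be canonical.
  refine of_enc (ite hf.ne_zero h (const Data.nil)) fun a => ?_
  by_cases h0 : f a = 0
  · simp [h0]; rfl
  · simp only [h0, ne_eq, not_false_eq_true, decide_true, if_true]
    refine (encNat_cons (by omega)).trans ?_
    rw [show 2 * f a / 2 = f a by omega, decide_eq_false (by omega)]; rfl

theorem of_eq {α β : Type} [Enc α] [Enc β] {f g : α → β} (hf : PolyTime f) (h : ∀ a, g a = f a) :
    PolyTime g :=
  (funext h : g = f) ▸ hf

end PolyTime

/-- Removal of the trailing bits of `m` that equal `b`; they are counted in unary by the binary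
length of `c`. -/
def strip (b : Bool) (c m : ℕ) : ℕ × ℕ :=
  if m ≠ 0 ∧ decide (m % 2 = 1) = b then strip b (2 * c + 1) (m / 2) else (c, m)
termination_by m
decreasing_by omega

/-- Attachment of as many trailing bits `b` to `m` as `c` has binary digits. -/
def push (b : Bool) (c m : ℕ) : ℕ :=
  if c ≠ 0 then push b (c / 2) (if b then 2 * m + 1 else 2 * m) else m
termination_by c
decreasing_by omega

theorem push_zero (b : Bool) (m : ℕ) : push b 0 m = m := by
  rw [push]; simp

theorem push_odd (b : Bool) (c m : ℕ) :
    push b (2 * c + 1) m = push b c (if b then 2 * m + 1 else 2 * m) := by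
  rw [push, if_pos (by omega), show (2 * c + 1) / 2 = c by omega]

/-- Carry propagation: the trailing ones become zeros and the bit above them is set. -/
theorem push_strip_true (c m : ℕ) :
    push false (strip true c m).1 (2 * ((strip true c m).2 / 2) + 1) = push false c (m + 1) := by
  induction m using Nat.strong_induction_on generalizing c with
  | _ m ih =>
    rw [strip]
    by_cases h : m ≠ 0 ∧ decide (m % 2 = 1) = true
    · have h1 : m % 2 = 1 := by simpa using h.2
      rw [if_pos h, ih _ (by omega), push_odd]
      simp only [Bool.false_eq_true, if_false]
      congr 1
      omega
    · rw [if_neg h]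
      simp only [decide_eq_true_eq] at h
      simp only
      congr 1
      omega

/-- Borrow propagation. For `m = 0` nothing is stripped, in accordance with truncated subtraction.
-/
theorem push_strip_false (c m : ℕ) :
    push true (strip false c m).1 (2 * ((strip false c m).2 / 2)) = push true c (m - 1) := by
  induction m using Nat.strong_induction_on generalizing c with
  | _ m ih =>
    rw [strip]
    by_cases h : m ≠ 0 ∧ decide (m % 2 = 1) = false
    · have h1 : ¬ m % 2 = 1 := by simpa using h.2
      rw [if_pos h, ih _ (by omega), push_odd]
      simp only [if_true]
      congr 1
      omega
    · rw [if_neg h]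
      simp only [decide_eq_false_iff_not] at h
      simp only
      congr 1
      omega

namespace PolyTime

theorem strip (b : Bool) : PolyTime (fun x : ℕ × ℕ => DMAC.strip b x.1 x.2) := by
  have hodd : PolyTime fun x : ℕ × ℕ => decide (decide (x.2 % 2 = 1) = b) := by
    cases b
    · exact of_eq (ite id.snd.odd (const false) (const true)) fun x => by
        by_cases h : x.2 % 2 = 1 <;> simp [h]
    · exact of_eq id.snd.odd fun x => by simp
  have ht : PolyTime fun x : ℕ × ℕ => decide (x.2 ≠ 0 ∧ decide (x.2 % 2 = 1) = b) :=
    of_eq (ite id.snd.ne_zero hodd (const false)) fun x => by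
      by_cases h : x.2 = 0 <;> simp [h]
  refine loop ht (pair id.fst.two_mul_add_one id.snd.half) (fun x => encSize x.2) 4
    (fun x => ?_) (fun x h => ?_) fun x h => ?_
  · have := encSize_prod x.1 x.2
    simp only [Prod.mk.eta] at this
    omega
  · rw [DMAC.strip, if_neg (of_decide_eq_false h)]
  · have h1 := of_decide_eq_true h
    have h2 := encSize_nat h1.1
    have h3 := encSize_two_mul_add_one_le x.1
    have h4 := encSize_prod x.1 x.2
    simp only [Prod.mk.eta] at h4
    refine ⟨by conv_rhs => rw [DMAC.strip, if_pos h1],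
      show encSize (x.2 / 2) < _ by omega, ?_⟩
    rw [encSize_prod]
    omega

theorem push (b : Bool) : PolyTime (fun x : ℕ × ℕ => DMAC.push b x.1 x.2) := by
  have hbit : PolyTime fun x : ℕ × ℕ => if b then 2 * x.2 + 1 else 2 * x.2 := by
    cases b
    · exact id.snd.two_mul
    · exact id.snd.two_mul_add_one
  refine snd (loop (r := fun x : ℕ × ℕ => (0, DMAC.push b x.1 x.2)) id.fst.ne_zero
    (pair id.fst.half hbit) (fun x => encSize x.1) 4 (fun x => ?_) (fun x h => ?_) fun x h => ?_)
  · have := encSize_prod x.1 x.2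
    simp only [Prod.mk.eta] at this
    omega
  · have h1 : x.1 = 0 := by simpa using h
    rw [DMAC.push, h1, if_neg (by simp)]
    exact Prod.ext h1.symm rfl
  · have h1 : x.1 ≠ 0 := by simpa using h
    have h2 := encSize_nat h1
    have h3 : encSize (if b then 2 * x.2 + 1 else 2 * x.2) ≤ encSize x.2 + 4 := by
      cases b
      · exact encSize_two_mul_le _
      · exact encSize_two_mul_add_one_le _
    have h4 := encSize_prod x.1 x.2
    simp only [Prod.mk.eta] at h4
    refine ⟨by conv_rhs => rw [DMAC.push, if_pos h1],
      show encSize (x.1 / 2) < _ by omega, ?_⟩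
    rw [encSize_prod]
    omega

variable {α : Type} [Enc α] {f g : α → ℕ}

theorem add_one (hf : PolyTime f) : PolyTime (fun a => f a + 1) := by
  have h := (strip true).comp (pair (const 0) hf)
  exact of_eq ((push false).comp (pair h.fst h.snd.half.two_mul_add_one)) fun a => by
    simp only [push_strip_true, push_zero]

theorem sub_one (hf : PolyTime f) : PolyTime (fun a => f a - 1) := by
  have h := (strip false).comp (pair (const 0) hf)
  exact of_eq ((push true).comp (pair h.fst h.snd.half.two_mul)) fun a => by
    simp only [push_strip_false, push_zero]

theorem add (hf : PolyTime f) (t : ℕ) : PolyTime (fun a => f a + t) := by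
  induction t with
  | zero => exact hf
  | succ t ih => exact ih.add_one

theorem quarter (hf : PolyTime f) : PolyTime (fun a => f a / 4) :=
  of_eq hf.half.half fun a => by omega

/-- Bits are read from the least significant one. The flag compares the parts already read, and a
later difference overrides it. -/
theorem lt (hf : PolyTime f) (hg : PolyTime g) : PolyTime (fun a => decide (f a < g a)) := by
  have h : PolyTime fun x : (ℕ × ℕ) × Bool => (((0, 0),
      if x.1.1 < x.1.2 then true else if x.1.2 < x.1.1 then false else x.2) :
      (ℕ × ℕ) × Bool) := by
    have ht : PolyTime fun x : (ℕ × ℕ) × Bool => if decide (x.1.1 ≠ 0) then true else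
        decide (x.1.2 ≠ 0) := ite id.fst.fst.ne_zero (const true) id.fst.snd.ne_zero
    have hs : PolyTime fun x : (ℕ × ℕ) × Bool => if decide (x.1.1 % 2 = 1) then
        (if decide (x.1.2 % 2 = 1) then x.2 else false) else
        (if decide (x.1.2 % 2 = 1) then true else x.2) :=
      ite id.fst.fst.odd (ite id.fst.snd.odd id.snd (const false))
        (ite id.fst.snd.odd (const true) id.snd)
    have hdec : ∀ n : ℕ, encSize (n / 2) ≤ encSize n := fun n => by
      rcases eq_or_ne n 0 with rfl | hn
      · exact le_rfl
      · have := encSize_nat hn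
        omega
    -- The numbers never grow; the constant 2 allows the flag to change from false (one node) to
    -- true (three nodes).
    refine loop ht (pair (pair id.fst.fst.half id.fst.snd.half) hs)
      (fun x => encSize x.1.1 + encSize x.1.2) 2 ?_ ?_ ?_
    · rintro ⟨⟨a, b⟩, c⟩
      simp only [encSize_prod]
      omega
    · rintro ⟨⟨a, b⟩, c⟩ h
      by_cases ha : a = 0 <;> by_cases hb : b = 0 <;> simp [ha, hb] at h ⊢
    · rintro ⟨⟨a, b⟩, c⟩ h
      have h0 : a ≠ 0 ∨ b ≠ 0 := by
        by_cases ha : a = 0 <;> by_cases hb : b = 0 <;> simp [ha, hb] at h ⊢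
      have ha := hdec a
      have hb := hdec b
      refine ⟨?_, ?_, ?_⟩
      · simp only [decide_eq_true_eq, Prod.mk.injEq, true_and]
        split_ifs <;> first | rfl | (exfalso; omega)
      · rcases h0 with h0 | h0 <;> have := encSize_nat h0 <;> simp only <;> omega
      · simp only [encSize_prod]
        have h1 := fun b : Bool => encSize_bool b
        have := (h1 c).1
        have := (h1 (if decide (a % 2 = 1) then (if decide (b % 2 = 1) then c else false) else
          (if decide (b % 2 = 1) then true else c))).2
        omega
  exact of_eq (h.comp (pair (pair hf hg) (const false))).snd fun a => by
    by_cases h1 : f a < g a <;> simp [h1]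

end PolyTime
/-! ### The programs of the reduction -/

/-- Coordinates of points as data of programs. -/
abbrev Triple : Type := ℕ × ℕ × ℕ

/-- The coordinates of a grid point as a triple. -/
def triple {n : ℕ} (x : Grid n 3) : Triple := (x 0, x 1, x 2)

/-- The sum of four numbers that differ by at most one, the first being the least. -/
def balancedSum (a b c d : ℕ) : ℕ :=
  4 * a + (if a < b then 1 else 0) + (if a < c then 1 else 0) + (if a < d then 1 else 0)

namespace PolyTime

variable {α : Type} [Enc α] {f g h k : α → ℕ}

theorem stepToward (hf : PolyTime f) (hg : PolyTime g) :
    PolyTime (fun a => DMAC.stepToward (f a) (g a)) :=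
  of_eq (ite (lt hf hg) hf.add_one (ite (lt hg hf) hf.sub_one hf)) fun a => by
    simp only [DMAC.stepToward, decide_eq_true_eq]

theorem clamp (hf : PolyTime f) (hg : PolyTime g) :
    PolyTime (fun a => DMAC.clamp (f a) (g a)) := by
  have hmin : PolyTime (fun a => min (g a) (f a)) :=
    of_eq (ite (lt hf hg) hf hg) fun a => by
      simp only [decide_eq_true_eq]
      split_ifs <;> omega
  exact of_eq (ite hmin.ne_zero hmin (const 1)) fun a => by
    simp only [DMAC.clamp, decide_eq_true_eq]
    split_ifs <;> omega

theorem balancedSum (hf : PolyTime f) (hg : PolyTime g) (hh : PolyTime h) (hk : PolyTime k) :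
    PolyTime (fun a => DMAC.balancedSum (f a) (g a) (h a) (k a)) := by
  have add_ite : ∀ {s l : α → ℕ}, PolyTime s → PolyTime l →
      PolyTime (fun a => s a + if f a < l a then 1 else 0) := fun hs hl =>
    of_eq (ite (lt hf hl) hs.add_one hs) fun a => by
      simp only [decide_eq_true_eq]
      split_ifs <;> rfl
  exact add_ite (add_ite (add_ite (of_eq hf.two_mul.two_mul fun a => by omega) hg) hh) hk

end PolyTime

/-- The corner of the unit cube around a point that is selected by the threshold `t`. -/
def cornerTriple (t : ℕ) (x : ℕ × Triple) : Triple :=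
  (clamp x.1 ((x.2.1 + t - 1) / 4), clamp x.1 ((x.2.2.1 + t - 1) / 4),
    clamp x.1 ((x.2.2.2 + t - 1) / 4))

theorem polyTime_cornerTriple (t : ℕ) : PolyTime (cornerTriple t) := by
  have h : PolyTime fun x : ℕ × Triple => x := .id
  exact .pair (h.fst.clamp (h.snd.fst.add t).sub_one.quarter)
    (.pair (h.fst.clamp (h.snd.snd.fst.add t).sub_one.quarter)
      (h.fst.clamp (h.snd.snd.snd.add t).sub_one.quarter))

/-- The step of the refined instance, from the values of the instance at four corners. -/
def stepTriple (x : Triple × Triple × Triple × Triple × Triple) : Triple :=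
  (stepToward x.1.1 (balancedSum x.2.1.1 x.2.2.1.1 x.2.2.2.1.1 x.2.2.2.2.1),
    stepToward x.1.2.1 (balancedSum x.2.1.2.1 x.2.2.1.2.1 x.2.2.2.1.2.1 x.2.2.2.2.2.1),
    stepToward x.1.2.2 (balancedSum x.2.1.2.2 x.2.2.1.2.2 x.2.2.2.1.2.2 x.2.2.2.2.2.2))

theorem polyTime_stepTriple : PolyTime stepTriple := by
  have h : PolyTime fun x : Triple × Triple × Triple × Triple × Triple => x := .id
  have h1 := h.snd.fst
  have h2 := h.snd.snd.fst
  have h3 := h.snd.snd.snd.fst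
  have h4 := h.snd.snd.snd.snd
  exact .pair (h.fst.fst.stepToward (h1.fst.balancedSum h2.fst h3.fst h4.fst))
    (.pair (h.fst.snd.fst.stepToward
        (h1.snd.fst.balancedSum h2.snd.fst h3.snd.fst h4.snd.fst))
      (h.fst.snd.snd.stepToward (h1.snd.snd.balancedSum h2.snd.snd h3.snd.snd h4.snd.snd)))

/-- By `chain` the four corner values are balanced, so their sum needs only doubling, increments and
comparisons. -/
theorem stepTriple_eq {n : ℕ} (hn : 1 ≤ n) {f : Grid n 3 → Grid n 3} (hf : ViolationFree f)
    (x : Grid (4 * n + 5) 3) :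
    stepTriple (triple x, triple (f (clampPoint hn (corner 0 (coords x)))),
      triple (f (clampPoint hn (corner 1 (coords x)))),
      triple (f (clampPoint hn (corner 2 (coords x)))),
      triple (f (clampPoint hn (corner 3 (coords x))))) = triple (refinement hn f x) := by
  have key : ∀ i, balancedSum (extend hn f (corner 0 (coords x)) i)
      (extend hn f (corner 1 (coords x)) i) (extend hn f (corner 2 (coords x)) i)
      (extend hn f (corner 3 (coords x)) i) = interpolate (extend hn f) (coords x) i := fun i => by
    have := (interpolable_extend hn hf).chain (coords x) i
    simp only [balancedSum, interpolate]
    split_ifs <;> omega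
  exact congrArg₂ Prod.mk (congrArg _ (key 0)) (congrArg₂ Prod.mk (congrArg _ (key 1))
    (congrArg _ (key 2)))

/-- The program for the refinement of the instance given by `n` and `M`, where `C t` computes
`cornerTriple t` and `S` computes `stepTriple`. -/
def refinedProgram (C : ℕ → Program) (S : Program) (n : ℕ) (M : Program) : Program :=
  .seq (.pair (.const (enc n)) .id)
    (.seq (.pair .right (.pair (.seq (C 0) M) (.pair (.seq (C 1) M)
      (.pair (.seq (C 2) M) (.seq (C 3) M))))) S)

/-- The source of `M` is copied but never run, so the bound does not involve its evaluation time. -/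
theorem polyTime_refinedProgram (C : ℕ → Program) (S : Program) :
    PolyTime (fun x : ℕ × Program => (4 * x.1 + 5, refinedProgram C S x.1 x.2)) := by
  have h : PolyTime fun x : ℕ × Program => x := .id
  have hC : ∀ t, PolyTime fun x : ℕ × Program => Program.seq (C t) x.2 := fun t =>
    .progSeq (.const _) h.snd
  refine .pair (.add (.of_eq h.fst.two_mul.two_mul fun x => by omega) 5) ?_
  exact .progSeq (.progPair (.progConst h.fst) (.const _))
    (.progSeq (.progPair (.const _) (.progPair (hC 0) (.progPair (hC 1)
      (.progPair (hC 2) (hC 3))))) (.const _))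

/-- Rounding a fixed point of the refined instance up to the original grid. -/
def roundTriple (x : (ℕ × Program) × Triple) : Triple :=
  ((x.2.1 + 2) / 4, (x.2.2.1 + 2) / 4, (x.2.2.2 + 2) / 4)

theorem polyTime_roundTriple : PolyTime roundTriple := by
  have h : PolyTime fun x : (ℕ × Program) × Triple => x := .id
  exact .pair (h.snd.fst.add 2).quarter (.pair (h.snd.snd.fst.add 2).quarter
    (h.snd.snd.snd.add 2).quarter)

/-- The points of the grids are of polynomial size. -/
theorem exists_encSize_triple_le : ∃ P : Polynomial ℕ, ∀ (n m : ℕ) (M : Program) (x : Grid m 3),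
    m ≤ 4 * n + 5 → encSize (triple x) ≤ P.eval (encSize (n, M)) := by
  have h : PolyTime fun x : ℕ × Program => x := .id
  obtain ⟨Q, hQ⟩ := ((PolyTime.of_eq (g := fun x : ℕ × Program => 4 * x.1) h.fst.two_mul.two_mul
    fun x => by omega).add 5).exists_encSize_le
  -- Three coordinates of size at most `2 * Q` each, and two pairing nodes.
  refine ⟨6 * Q + 2, fun n m M x hm => ?_⟩
  have h1 : ∀ i, encSize (x i : ℕ) ≤ 2 * Q.eval (encSize (n, M)) := fun i =>
    (encSize_le_of_le ((x i).2.2.trans hm)).trans (Nat.mul_le_mul_left 2 (hQ (n, M)))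
  have := h1 0; have := h1 1; have := h1 2
  simp only [triple, encSize_prod, Polynomial.eval_add, Polynomial.eval_mul,
    Polynomial.eval_ofNat]
  simp only [encSize_prod] at *
  omega

theorem exists_represents_refinedProgram : ∃ (C : ℕ → Program) (S : Program) (q : Polynomial ℕ),
    ∀ (n : ℕ) (hn : 1 ≤ n) (f : Grid n 3 → Grid n 3), ViolationFree f →
      ∀ (M : Program) (T : ℕ), Represents M f T →
        Represents (refinedProgram C S n M) (refinement hn f)
          (q.eval ((encInstance n M).size + T)) := by
  choose C p hC using polyTime_cornerTriple
  obtain ⟨S, r, hS⟩ := polyTime_stepTriple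
  obtain ⟨P, hP⟩ := exists_encSize_triple_le
  -- `W` bounds the inputs of all fixed subprograms; the largest are five triples with four pairing
  -- nodes, and the pair of `n` and a triple.
  set W : Polynomial ℕ := 5 * P + Polynomial.X + 4 with hW
  refine ⟨C, S, 4 * W + (p 0 + p 1 + p 2 + p 3 + r).comp W + 4 * Polynomial.X + 20,
    fun n hn f hf M T hM x => ?_⟩
  set N := (encInstance n M).size with hN
  have hPN : ∀ {m : ℕ} (y : Grid m 3), m ≤ 4 * n + 5 → encSize (triple y) ≤ P.eval (N + T) :=
    fun y hm => (hP n _ M y hm).trans (eval_mono P (Nat.le_add_right _ _))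
  have hWe : W.eval (N + T) = 5 * P.eval (N + T) + (N + T) + 4 := by simp [hW]
  have hnN : encSize n ≤ N := by
    rw [hN, show (encInstance n M).size = encSize (n, M) from rfl, encSize_prod]
    omega
  have hx := hPN x le_rfl
  -- Clamping ensures that `M` is called only on points of its grid, where the bound `T` applies.
  have hcall : ∀ t, RunsWithin (.seq (C t) M) (enc (n, triple x))
      (enc (triple (f (clampPoint hn (corner t (coords x))))))
      ((p t).eval (W.eval (N + T)) + T + 1) := fun t =>
    ((hC t (n, triple x)).mono (eval_mono (p t) (by rw [encSize_prod]; omega))).seq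
      (hM (clampPoint hn (corner t (coords x))))
  have hstep := hS (triple x, triple (f (clampPoint hn (corner 0 (coords x)))),
      triple (f (clampPoint hn (corner 1 (coords x)))),
      triple (f (clampPoint hn (corner 2 (coords x)))),
      triple (f (clampPoint hn (corner 3 (coords x)))))
  rw [stepTriple_eq hn hf x] at hstep
  have hy : ∀ t, encSize (triple (f (clampPoint hn (corner t (coords x))))) ≤ P.eval (N + T) :=
    fun t => hPN _ (by omega)
  have hstep' := hstep.mono (eval_mono r (b := W.eval (N + T)) (by
    have := hy 0; have := hy 1; have := hy 2; have := hy 3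
    simp only [encSize_prod]
    omega))
  have hconst : RunsWithin (.pair (.const (enc n)) .id) (enc (triple x)) (enc (n, triple x))
      (encSize (triple x) + encSize n + encSize (triple x) + 1) :=
    RunsWithin.pair ⟨_, le_rfl, .const _ _⟩ ⟨_, le_rfl, .id _⟩
  have hright : RunsWithin .right (enc (n, triple x)) (enc (triple x)) (encSize (n, triple x)) :=
    ⟨_, le_rfl, .right _⟩
  rw [encSize_prod] at hright
  refine (hconst.seq ((hright.pair ((hcall 0).pair ((hcall 1).pair
    ((hcall 2).pair (hcall 3))))).seq hstep')).mono ?_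
  simp only [Polynomial.eval_add, Polynomial.eval_mul, Polynomial.eval_comp, Polynomial.eval_X,
    Polynomial.eval_ofNat]
  omega

end DMAC

/-- There are a polynomial-time reduction `R` and a polynomial-time back-translation `B` for
violation-free three-dimensional instances `f` on `{1, …, n}^3`. The new grid `{1, …, 4 n + 5}^3`
is the quarter-integer grid `{0, 1/4, 1/2, …, n + 1}^3` in units of `1/4`: index `k` stands for the
coordinate `(k - 1) / 4`. -/
theorem mainTheorem10 :
    ∃ (R B : DMAC.Program) (q : Polynomial ℕ),
      ∀ (n : ℕ), 1 ≤ n → ∀ f : DMAC.Grid n 3 → DMAC.Grid n 3, DMAC.ViolationFree f →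
        ∃ f' : DMAC.Grid (4 * n + 5) 3 → DMAC.Grid (4 * n + 5) 3,
          DMAC.ViolationFree f' ∧ DMAC.IsOneDUnique f' ∧
          ∃ xstar : DMAC.Grid (4 * n + 5) 3,
            (∀ y, Function.IsFixedPt f' y ↔ y = xstar) ∧
            ∃ p : DMAC.Grid n 3, IsLeast (Function.fixedPoints f) p ∧
              ∀ (M : DMAC.Program) (T : ℕ), DMAC.Represents M f T →
                (∃ M' : DMAC.Program,
                  DMAC.RunsWithin R (DMAC.encInstance n M) (DMAC.encInstance (4 * n + 5) M')
                    (q.eval (DMAC.encInstance n M).size) ∧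
                  DMAC.Represents M' f' (q.eval ((DMAC.encInstance n M).size + T))) ∧
                DMAC.RunsWithin B
                  (.cons (DMAC.encInstance n M) (DMAC.encPoint xstar)) (DMAC.encPoint p)
                  (q.eval ((DMAC.encInstance n M).size + T)) := by
  obtain ⟨C, S, qM, hM⟩ := DMAC.exists_represents_refinedProgram
  obtain ⟨R, qR, hR⟩ := DMAC.polyTime_refinedProgram C S
  obtain ⟨B, qB, hB⟩ := DMAC.polyTime_roundTriple
  obtain ⟨P, hP⟩ := DMAC.exists_encSize_triple_le
  -- The argument of `qB` bounds the input of `B`: the instance, a grid point and one pairing node.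
  refine ⟨R, B, qM + qR + qB.comp (Polynomial.X + P + 1), fun n hn f hf => ?_⟩
  obtain ⟨x, hx, p, hp, hleast⟩ := DMAC.exists_fixed_refinement hn hf
  refine ⟨DMAC.refinement hn f, DMAC.violationFree_refinement hn hf,
    DMAC.isOneDUnique_refinement hn hf, x, hx, p, hleast, fun M T hMf =>
    ⟨⟨DMAC.refinedProgram C S n M, (hR (n, M)).mono ?_, fun y => (hM n hn f hf M T hMf y).mono ?_⟩,
      ?_⟩⟩
  · simp only [Polynomial.eval_add]
    exact (Nat.le_add_left _ _).trans (Nat.le_add_right _ _)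
  · simp only [Polynomial.eval_add]
    omega
  · have h1 := hB ((n, M), DMAC.triple x)
    have h2 : DMAC.roundTriple ((n, M), DMAC.triple x) = DMAC.triple p := by
      simp only [DMAC.roundTriple, DMAC.triple, hp]
    rw [h2] at h1
    have h3 := hP n _ M x le_rfl
    have h4 : DMAC.encSize (n, M) = (DMAC.encInstance n M).size := rfl
    rw [h4] at h3
    have h5 := DMAC.eval_mono P (Nat.le_add_right (DMAC.encInstance n M).size T)
    refine h1.mono ((DMAC.eval_mono qB (b := (Polynomial.X + P + 1 : Polynomial ℕ).eval
      ((DMAC.encInstance n M).size + T)) ?_).trans ?_)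
    · simp only [DMAC.encSize_prod ((n, M) : ℕ × DMAC.Program), Polynomial.eval_add,
        Polynomial.eval_X, Polynomial.eval_one]
      omega
    · rw [Polynomial.eval_add (p := qM + qR), Polynomial.eval_comp]
      exact Nat.le_add_left _ _
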